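/- A \emph{shortened polyomino} of size $n$ is a pair $(P,Q)$ of lattice paths $P=P_1\cdots P_n$ and $Q=Q_1\cdots Q_n$ with unit north steps $N$ and unit east steps $E$, which begin at the same vertex (the origin) and end at the same vertex, such that $P$ stays weakly above $Q$ and the two paths have no common $N$-step (common $E$-steps are allowed). Let $\mathcal{H}_n$ be the set of these pairs. For $(P,Q)\in\mathcal{H}_n$ and $i\in\{1,\dots,n\}$, the projection of the $i$-th step of $Q$ on $P$ is the unique $E$-step of $P$ in the same column if $Q_i=E$, and the unique $N$-step of $P$ in the same row if $Q_i=N$; let $\mathrm{area}_{(P,Q)}(i)$ be the number of unit squares between the $i$-th step of $Q$ and its projection on $P$ (in that column, respectively row). Let $\mathrm{Valley}(Q)=\{i : Q_iQ_{i+1}=EN\}$, $\mathrm{val}(Q)=|\mathrm{Valley}(Q)|$, and $$\mathrm{vcarea}(P,Q)=\sum_{i\in\mathrm{Valley}(Q)}\mathrm{area}_{(P,Q)}(i),\qquad \mathrm{vrarea}(P,Q)=\sum_{i\in\mathrm{Valley}(Q)}\mathrm{area}_{(P,Q)}(i+1).$$ \textbf{Theorem.} For any $n\ge 1$, in the polynomial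 ring $\mathbb{Z}[q,t]$, $$\sum_{(P,Q)\in\mathcal{H}_n} q^{\mathrm{vcarea}(P,Q)}\,t^{\mathrm{val}(Q)}=\sum_{(P,Q)\in\mathcal{H}_n} q^{\mathrm{vrarea}(P,Q)}\,t^{\mathrm{val}(Q)}.$$ -/

import Mathlib

open Finset

namespace ShortenedPolyomino

/-- The two kinds of unit steps: north `N = (0,1)` and east `E = (1,0)`. -/
inductive Step where
  | N
  | E
deriving DecidableEq

instance : Fintype Step where
  elems := {Step.N, Step.E}
  complete := by intro s; cases s <;> simp

/-- A lattice path with `n` north/east steps, taken to start at the origin. The steps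
`0, …, n - 1` of the code are the steps `1, …, n` of the usual numbering. -/
abbrev Path (n : ℕ) : Type := Fin n → Step

/-- The lattice point reached after the first `k` steps of `P` (for `k ≤ n`). In particular
step `i` of `P` is the unit segment that starts at `vertex P i`. -/
def vertex {n : ℕ} (P : Path n) (k : ℕ) : ℕ × ℕ :=
  (#{i : Fin n | (i : ℕ) < k ∧ P i = Step.E}, #{i : Fin n | (i : ℕ) < k ∧ P i = Step.N})

/-- Both paths start at the origin. They end at the same point, `P` stays weakly above `Q`
(the `k`-th vertices of the two paths lie on the same antidiagonal `x + y = k`, so that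
it suffices to compare their heights), and no `N`-step of `P` is an `N`-step of `Q`. -/
structure IsShortened {n : ℕ} (P Q : Path n) : Prop where
  same_end : vertex P n = vertex Q n
  weakly_above : ∀ k ≤ n, (vertex Q k).2 ≤ (vertex P k).2
  no_common_north : ∀ i j : Fin n, P i = Step.N → Q j = Step.N → vertex P i ≠ vertex Q j

instance {n : ℕ} (P Q : Path n) : Decidable (IsShortened P Q) :=
  decidable_of_iff
    (vertex P n = vertex Q n ∧
      (∀ k ≤ n, (vertex Q k).2 ≤ (vertex P k).2) ∧
      ∀ i j : Fin n, P i = Step.N → Q j = Step.N → vertex P i ≠ vertex Q j)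
    ⟨fun h => ⟨h.1, h.2.1, h.2.2⟩, fun h => ⟨h.1, h.2, h.3⟩⟩

/-- The set of shortened polyominoes whose two boundary paths have `n` steps. -/
def shortened (n : ℕ) : Finset (Path n × Path n) :=
  {p | IsShortened p.1 p.2}

/-- Step `j` of `P` is the projection of step `i` of `Q`: an `E`-step is projected
vertically onto the `E`-step of `P` in the same column, an `N`-step is projected
horizontally onto the `N`-step of `P` in the same row. -/
def IsProj {n : ℕ} (P Q : Path n) (i j : Fin n) : Prop :=
  P j = Q i ∧
    match Q i with
    | Step.E => (vertex P j).1 = (vertex Q i).1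
    | Step.N => (vertex P j).2 = (vertex Q i).2

/-- The projection of step `i` of `Q` on `P`. It exists and is unique for all shortened
polyominoes, see `IsShortened.existsUnique_isProj`; the value `i` otherwise is arbitrary. -/
noncomputable def proj {n : ℕ} (P Q : Path n) (i : Fin n) : Fin n :=
  open Classical in if h : ∃ j, IsProj P Q i j then h.choose else i

/-- The unit squares `[a, a + 1] × [b, b + 1]`, written `(a, b)`, between step `i` of `Q`
and its projection on `P`. -/
noncomputable def squaresBetween {n : ℕ} (P Q : Path n) (i : Fin n) : Finset (ℕ × ℕ) :=
  match Q i with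
  | Step.E => {(vertex Q i).1} ×ˢ Finset.Ico (vertex Q i).2 (vertex P (proj P Q i)).2
  | Step.N => Finset.Ico (vertex P (proj P Q i)).1 (vertex Q i).1 ×ˢ {(vertex Q i).2}

/-- The number of squares between step `i` of `Q` and its projection on `P`. -/
noncomputable def area {n : ℕ} (P Q : Path n) (i : Fin n) : ℕ :=
  #(squaresBetween P Q i)

/-- The valleys of `Q`, as the set of pairs `(i, i + 1)` of consecutive step indices with
`Q i = E` and `Q (i + 1) = N`. A valley is determined by its first index `i`. -/
def valleys {n : ℕ} (Q : Path n) : Finset (Fin n × Fin n) :=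
  {p | (p.2 : ℕ) = p.1 + 1 ∧ Q p.1 = Step.E ∧ Q p.2 = Step.N}

/-- The number of valleys. -/
def val {n : ℕ} (Q : Path n) : ℕ := #(valleys Q)

/-- Valley-column area: the sum of `area i` over all valleys `(i, i + 1)` of `Q`. -/
noncomputable def vcarea {n : ℕ} (P Q : Path n) : ℕ :=
  ∑ p ∈ valleys Q, area P Q p.1

/-- Valley-row area: the sum of `area (i + 1)` over all valleys `(i, i + 1)` of `Q`. -/
noncomputable def vrarea {n : ℕ} (P Q : Path n) : ℕ :=
  ∑ p ∈ valleys Q, area P Q p.2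

theorem exists_step_of_lt {n : ℕ} (P : Path n) (s : Step) (m : ℕ) :
    ∀ k : ℕ, m < #{i : Fin n | (i : ℕ) < k ∧ P i = s} →
      ∃ j : Fin n, P j = s ∧ #{i : Fin n | (i : ℕ) < (j : ℕ) ∧ P i = s} = m := by
  intro k
  induction k with
  | zero => intro h; simp at h
  | succ k ih =>
    intro h
    by_cases hm : m < #{i : Fin n | (i : ℕ) < k ∧ P i = s}
    · exact ih hm
    by_cases hk : ∃ hk : k < n, P ⟨k, hk⟩ = s
    · obtain ⟨hk, hs⟩ := hk
      refine ⟨⟨k, hk⟩, hs, ?_⟩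
      have hins : ({i : Fin n | (i : ℕ) < k + 1 ∧ P i = s} : Finset (Fin n)) ⊆
          insert ⟨k, hk⟩ ({i : Fin n | (i : ℕ) < k ∧ P i = s} : Finset (Fin n)) := by
        intro i hi
        simp only [mem_filter, mem_univ, true_and, mem_insert, Fin.ext_iff] at hi ⊢
        by_cases h1 : (i : ℕ) = k
        · exact Or.inl h1
        · exact Or.inr ⟨by omega, hi.2⟩
      have h1 := card_le_card hins
      have h2 := card_insert_le (⟨k, hk⟩ : Fin n) {i : Fin n | (i : ℕ) < k ∧ P i = s}
      show #{i : Fin n | (i : ℕ) < k ∧ P i = s} = m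
      omega
    · exfalso
      apply hm
      refine lt_of_lt_of_le h (card_le_card ?_)
      intro i hi
      simp only [mem_filter, mem_univ, true_and] at hi ⊢
      refine ⟨?_, hi.2⟩
      by_contra h1
      have h2 : (i : ℕ) = k := by omega
      subst h2
      exact hk ⟨i.2, hi.2⟩

theorem count_lt {n : ℕ} (P : Path n) (s : Step) (j : Fin n) (k : ℕ) (hjk : (j : ℕ) < k)
    (hj : P j = s) : #{i : Fin n | (i : ℕ) < (j : ℕ) ∧ P i = s} <
      #{i : Fin n | (i : ℕ) < k ∧ P i = s} := by
  apply card_lt_card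
  refine ⟨fun i hi => ?_, fun hsub => ?_⟩
  · simp only [mem_filter, mem_univ, true_and] at hi ⊢
    exact ⟨by omega, hi.2⟩
  · have hmem : j ∈ ({i : Fin n | (i : ℕ) < (j : ℕ) ∧ P i = s} : Finset (Fin n)) :=
      hsub (by simp [hjk, hj])
    simp at hmem

theorem existsUnique_step {n : ℕ} (P Q : Path n) (s : Step) (i : Fin n) (hi : Q i = s)
    (hPQ : #{l : Fin n | (l : ℕ) < n ∧ P l = s} = #{l : Fin n | (l : ℕ) < n ∧ Q l = s}) :
    ∃! j : Fin n, P j = s ∧ #{l : Fin n | (l : ℕ) < (j : ℕ) ∧ P l = s} =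
      #{l : Fin n | (l : ℕ) < (i : ℕ) ∧ Q l = s} := by
  obtain ⟨j, hj, hc⟩ := exists_step_of_lt P s _ n (hPQ ▸ count_lt Q s i n i.2 hi)
  refine ⟨j, ⟨hj, hc⟩, fun j' hj' => ?_⟩
  rcases lt_trichotomy (j' : ℕ) j with h | h | h
  · have := count_lt P s j' j h hj'.1
    omega
  · exact Fin.ext h
  · have := count_lt P s j j' h hj
    omega

/-- Every step of `Q` has exactly one projection on `P`. -/
theorem IsShortened.existsUnique_isProj {n : ℕ} {P Q : Path n} (h : IsShortened P Q)
    (i : Fin n) : ∃! j, IsProj P Q i j := by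
  have h1 := congrArg Prod.fst h.same_end
  have h2 := congrArg Prod.snd h.same_end
  cases hi : Q i with
  | E => simpa only [IsProj, hi, vertex] using existsUnique_step P Q Step.E i hi h1
  | N => simpa only [IsProj, hi, vertex] using existsUnique_step P Q Step.N i hi h2

theorem IsShortened.isProj_proj {n : ℕ} {P Q : Path n} (h : IsShortened P Q) (i : Fin n) :
    IsProj P Q i (proj P Q i) := by
  have hex := (h.existsUnique_isProj i).exists
  unfold proj
  rw [dif_pos hex]
  exact hex.choose_spec

end ShortenedPolyomino

namespace ShortenedPolyomino

/-! Reflection in an antidiagonal exchanges rows with columns. It fixes the number of valleys and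
swaps the two valley areas, but it turns common `N`-steps into common `E`-steps, so it does not act
on shortened polyominoes. It does act on the larger set `above n`, where common steps of both kinds
are allowed, and there the two generating functions agree (`sum_above_weight`).

To return to `shortened n`, cut a pair at its first common `N`-step, if there is one: what precedes
is a shortened polyomino of size `i`, what follows is any pair in `above j`, and `n = i + 1 + j`
(`sum_above_eq`, `sum_aboveFirst_weight`). Both valley areas are additive under this cut. The only
new valley arises when the prefix ends in `E`; it has area `0` and contributes a factor `t`.
Deleting a final `E` relates prefixes ending in `E` to size `i - 1`
(`sum_shortened_weight_mul_endsEast`). All terms except the sum over `shortened n` thus agree by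
induction, and they cancel. -/

/-- The number of steps of kind `s` among the first `k` steps of `P`. -/
def stepCount {n : ℕ} (P : Path n) (s : Step) (k : ℕ) : ℕ :=
  #{i : Fin n | (i : ℕ) < k ∧ P i = s}

theorem vertex_eq {n : ℕ} (P : Path n) (k : ℕ) :
    vertex P k = (stepCount P Step.E k, stepCount P Step.N k) := rfl

theorem stepCount_eq_sum {n : ℕ} (P : Path n) (s : Step) (k : ℕ) :
    stepCount P s k = ∑ i : Fin n, if (i : ℕ) < k ∧ P i = s then 1 else 0 := by
  rw [stepCount, card_filter]

@[simp]
theorem stepCount_zero {n : ℕ} (P : Path n) (s : Step) : stepCount P s 0 = 0 := by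
  simp [stepCount]

theorem stepCount_of_le {n : ℕ} (P : Path n) (s : Step) {k : ℕ} (h : n ≤ k) :
    stepCount P s k = stepCount P s n := by
  unfold stepCount
  congr 1
  ext i
  have := i.2
  simp only [mem_filter, mem_univ, true_and, and_congr_left_iff]
  intro _
  omega

theorem stepCount_succ {n : ℕ} (P : Path n) (s : Step) (j : Fin n) :
    stepCount P s (j + 1) = stepCount P s j + if P j = s then 1 else 0 := by
  have h : (if P j = s then 1 else 0) = ∑ i : Fin n, if i = j then (if P j = s then 1 else 0)
      else 0 := by simp
  rw [stepCount_eq_sum, stepCount_eq_sum, h, ← sum_add_distrib]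
  refine sum_congr rfl fun i _ => ?_
  by_cases hij : i = j
  · subst hij
    simp
  · have : (i : ℕ) ≠ j := fun h => hij (Fin.ext h)
    have h2 : (i : ℕ) < j + 1 ↔ (i : ℕ) < j := by omega
    simp [hij, h2]

theorem stepCount_add_stepCount {n : ℕ} (P : Path n) :
    ∀ k ≤ n, stepCount P Step.E k + stepCount P Step.N k = k := by
  intro k
  induction k with
  | zero => simp
  | succ k ih =>
    intro hk
    have h1 := stepCount_succ P Step.E ⟨k, hk⟩
    have h2 := stepCount_succ P Step.N ⟨k, hk⟩
    have h3 := ih (by omega)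
    cases h : P ⟨k, hk⟩ <;> simp [h] at h1 h2 <;> omega

theorem stepCount_append {m n : ℕ} (P : Path m) (P' : Path n) (s : Step) (k : ℕ) :
    stepCount (Fin.append P P') s k = stepCount P s k + stepCount P' s (k - m) := by
  simp only [stepCount_eq_sum, Fin.sum_univ_add, Fin.append_left, Fin.append_right,
    Fin.val_castAdd, Fin.val_natAdd]
  congr 1
  refine sum_congr rfl fun i _ => ?_
  have : m + (i : ℕ) < k ↔ (i : ℕ) < k - m := by omega
  simp only [this]

/-- This form treats rows and columns alike: matching steps have the same rank among the steps of
their kind. -/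
theorem isProj_iff {n : ℕ} {P Q : Path n} {i j : Fin n} :
    IsProj P Q i j ↔ P j = Q i ∧ stepCount P (Q i) j = stepCount Q (Q i) i := by
  cases h : Q i <;> simp [IsProj, h, vertex_eq]

/-! ### Weakly ordered pairs and common north steps -/

/-- Pairs of paths with common end points, the first one weakly above the second one. -/
structure IsAbove {n : ℕ} (P Q : Path n) : Prop where
  stepCount_eq : ∀ s, stepCount P s n = stepCount Q s n
  stepCount_le : ∀ k, stepCount Q Step.N k ≤ stepCount P Step.N k

/-- The paths `P` and `Q` share the step of index `k`, which is an `N`-step. -/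
structure IsCommonNorth {n : ℕ} (P Q : Path n) (k : ℕ) : Prop where
  left : ∃ h : k < n, P ⟨k, h⟩ = Step.N
  right : ∃ h : k < n, Q ⟨k, h⟩ = Step.N
  stepCount_eq : ∀ s, stepCount P s k = stepCount Q s k

theorem isShortened_iff {n : ℕ} {P Q : Path n} :
    IsShortened P Q ↔ IsAbove P Q ∧ ∀ k, ¬ IsCommonNorth P Q k := by
  constructor
  · intro h
    have he := h.same_end
    rw [vertex_eq, vertex_eq, Prod.mk.injEq] at he
    have he' : ∀ s, stepCount P s n = stepCount Q s n := by
      intro s; cases s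
      exacts [he.2, he.1]
    refine ⟨⟨he', fun k => ?_⟩, fun k hk => ?_⟩
    · rcases le_total k n with hk | hk
      · exact h.weakly_above k hk
      · rw [stepCount_of_le P _ hk, stepCount_of_le Q _ hk, he']
    · obtain ⟨hn, h1⟩ := hk.left
      obtain ⟨_, h2⟩ := hk.right
      refine h.no_common_north _ _ h1 h2 ?_
      rw [vertex_eq, vertex_eq, Prod.mk.injEq]
      exact ⟨hk.stepCount_eq _, hk.stepCount_eq _⟩
  · rintro ⟨h, hc⟩
    refine ⟨?_, fun k _ => h.stepCount_le k, fun i j hi hj hij => ?_⟩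
    · rw [vertex_eq, vertex_eq, h.stepCount_eq, h.stepCount_eq]
    · rw [vertex_eq, vertex_eq, Prod.mk.injEq] at hij
      have h1 := stepCount_add_stepCount P i i.2.le
      have h2 := stepCount_add_stepCount Q j j.2.le
      -- The coordinates of a vertex sum to its index, so equal vertices have equal indices.
      have h3 : i = j := Fin.ext (by omega)
      subst h3
      refine hc i ⟨⟨i.2, hi⟩, ⟨i.2, hj⟩, fun s => ?_⟩
      cases s
      exacts [hij.2, hij.1]

theorem IsAbove.existsUnique_isProj {n : ℕ} {P Q : Path n} (h : IsAbove P Q) (i : Fin n) :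
    ∃! j, IsProj P Q i j := by
  simp only [isProj_iff]
  exact existsUnique_step P Q (Q i) i rfl (h.stepCount_eq _)

theorem IsAbove.proj_eq {n : ℕ} {P Q : Path n} (h : IsAbove P Q) {i j : Fin n}
    (hj : IsProj P Q i j) : proj P Q i = j := by
  have hex : ∃ j, IsProj P Q i j := ⟨j, hj⟩
  unfold proj
  rw [dif_pos hex]
  exact (h.existsUnique_isProj i).unique hex.choose_spec hj

/-- The two steps start on the antidiagonals `x + y = j` and `x + y = i` and share one coordinate,
so the other differs by the difference of the indices. Areas in this form are easy to translate and
to reflect. -/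
theorem IsAbove.area_eq {n : ℕ} {P Q : Path n} (h : IsAbove P Q) {i j : Fin n}
    (hj : IsProj P Q i j) :
    area P Q i = if Q i = Step.E then (j : ℕ) - i else (i : ℕ) - j := by
  have h0 := isProj_iff.1 hj
  have h1 := stepCount_add_stepCount P j j.2.le
  have h2 := stepCount_add_stepCount Q i i.2.le
  cases hi : Q i <;> rw [hi] at h0 <;>
    simp only [area, squaresBetween, hi, h.proj_eq hj, card_product, card_singleton,
      Nat.card_Ico, vertex_eq] <;> simp <;> omega

theorem IsAbove.exists_isProj_area {n : ℕ} {P Q : Path n} (h : IsAbove P Q) (i : Fin n) :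
    ∃ j, IsProj P Q i j ∧
      area P Q i = if Q i = Step.E then (j : ℕ) - i else (i : ℕ) - j :=
  let ⟨j, hj, _⟩ := h.existsUnique_isProj i
  ⟨j, hj, h.area_eq hj⟩

/-! ### Concatenation -/

section append

variable {m n : ℕ} {P Q : Path m} {P' Q' : Path n}

/-- By `h` the cut is at a common vertex, so beyond it both paths have their counts shifted by the
same amounts. -/
theorem isAbove_append (h : ∀ s, stepCount P s m = stepCount Q s m) :
    IsAbove (Fin.append P P') (Fin.append Q Q') ↔ IsAbove P Q ∧ IsAbove P' Q' := by
  constructor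
  · intro H
    refine ⟨⟨h, fun k => ?_⟩, fun s => ?_, fun k => ?_⟩
    · rcases le_total k m with hk | hk
      · have := H.stepCount_le k
        simpa [stepCount_append, Nat.sub_eq_zero_of_le hk] using this
      · rw [stepCount_of_le P _ hk, stepCount_of_le Q _ hk, h]
    · have := H.stepCount_eq s
      rw [stepCount_append, stepCount_append, stepCount_of_le P _ (Nat.le_add_right m n),
        stepCount_of_le Q _ (Nat.le_add_right m n), h] at this
      simpa using this
    · have := H.stepCount_le (m + k)
      rw [stepCount_append, stepCount_append, stepCount_of_le P _ (Nat.le_add_right m k),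
        stepCount_of_le Q _ (Nat.le_add_right m k), h] at this
      simpa using this
  · rintro ⟨h1, h2⟩
    refine ⟨fun s => ?_, fun k => ?_⟩
    · rw [stepCount_append, stepCount_append, stepCount_of_le P _ (Nat.le_add_right m n),
        stepCount_of_le Q _ (Nat.le_add_right m n), h]
      simpa using h2.stepCount_eq s
    · rw [stepCount_append, stepCount_append]
      exact add_le_add (h1.stepCount_le k) (h2.stepCount_le _)

theorem isCommonNorth_append_of_lt {k : ℕ} (hk : k < m) :
    IsCommonNorth (Fin.append P P') (Fin.append Q Q') k ↔ IsCommonNorth P Q k := by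
  have h1 : ∀ (R : Path m) (R' : Path n), (∃ h : k < m + n, Fin.append R R' ⟨k, h⟩ = Step.N) ↔
      ∃ h : k < m, R ⟨k, h⟩ = Step.N := by
    intro R R'
    have : Fin.append R R' ⟨k, by omega⟩ = R ⟨k, hk⟩ := Fin.append_left R R' ⟨k, hk⟩
    constructor
    · rintro ⟨_, h⟩
      exact ⟨hk, this ▸ h⟩
    · rintro ⟨_, h⟩
      exact ⟨by omega, this.trans h⟩
  have h2 : ∀ (R : Path m) (R' : Path n) (s : Step),
      stepCount (Fin.append R R') s k = stepCount R s k := by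
    intro R R' s
    simp [stepCount_append, Nat.sub_eq_zero_of_le hk.le]
  constructor
  · rintro ⟨a, b, c⟩
    exact ⟨(h1 _ _).1 a, (h1 _ _).1 b, by simpa only [h2] using c⟩
  · rintro ⟨a, b, c⟩
    exact ⟨(h1 _ _).2 a, (h1 _ _).2 b, by simpa only [h2] using c⟩

theorem isCommonNorth_append_add (h : ∀ s, stepCount P s m = stepCount Q s m) (k : ℕ) :
    IsCommonNorth (Fin.append P P') (Fin.append Q Q') (m + k) ↔ IsCommonNorth P' Q' k := by
  have h1 : ∀ (R : Path m) (R' : Path n),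
      (∃ h : m + k < m + n, Fin.append R R' ⟨m + k, h⟩ = Step.N) ↔
      ∃ h : k < n, R' ⟨k, h⟩ = Step.N := by
    intro R R'
    constructor
    · rintro ⟨hk, h⟩
      exact ⟨by omega, (Fin.append_right R R' ⟨k, by omega⟩).symm.trans h⟩
    · rintro ⟨hk, h⟩
      exact ⟨by omega, (Fin.append_right R R' ⟨k, hk⟩).trans h⟩
  have h2 : ∀ s, stepCount (Fin.append P P') s (m + k) = stepCount (Fin.append Q Q') s (m + k) ↔
      stepCount P' s k = stepCount Q' s k := by
    intro s
    rw [stepCount_append, stepCount_append, stepCount_of_le P _ (Nat.le_add_right m k),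
        stepCount_of_le Q _ (Nat.le_add_right m k), h]
    simp
  constructor
  · rintro ⟨a, b, c⟩
    exact ⟨(h1 _ _).1 a, (h1 _ _).1 b, fun s => (h2 s).1 (c s)⟩
  · rintro ⟨a, b, c⟩
    exact ⟨(h1 _ _).2 a, (h1 _ _).2 b, fun s => (h2 s).2 (c s)⟩

theorem forall_not_isCommonNorth_append (h : ∀ s, stepCount P s m = stepCount Q s m) :
    (∀ k, ¬ IsCommonNorth (Fin.append P P') (Fin.append Q Q') k) ↔
      (∀ k, ¬ IsCommonNorth P Q k) ∧ ∀ k, ¬ IsCommonNorth P' Q' k := by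
  constructor
  · refine fun H => ⟨fun k hk => ?_, fun k => ?_⟩
    · obtain ⟨hkm, _⟩ := hk.left
      exact H k ((isCommonNorth_append_of_lt hkm).2 hk)
    · rw [← isCommonNorth_append_add h]
      exact H _
  · rintro ⟨h1, h2⟩ k
    rcases lt_or_ge k m with hk | hk
    · rw [isCommonNorth_append_of_lt hk]
      exact h1 k
    · obtain ⟨k, rfl⟩ := Nat.exists_eq_add_of_le hk
      rw [isCommonNorth_append_add h]
      exact h2 k

theorem isShortened_append (h : ∀ s, stepCount P s m = stepCount Q s m) :
    IsShortened (Fin.append P P') (Fin.append Q Q') ↔ IsShortened P Q ∧ IsShortened P' Q' := by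
  rw [isShortened_iff, isShortened_iff, isShortened_iff, isAbove_append h,
    forall_not_isCommonNorth_append h]
  tauto

theorem area_append_left (h : IsAbove P Q) (h' : IsAbove P' Q') (i : Fin m) :
    area (Fin.append P P') (Fin.append Q Q') (Fin.castAdd n i) = area P Q i := by
  obtain ⟨j, hj, ha⟩ := h.exists_isProj_area i
  have H := (isAbove_append h.stepCount_eq).2 ⟨h, h'⟩
  have hp : IsProj (Fin.append P P') (Fin.append Q Q') (Fin.castAdd n i) (Fin.castAdd n j) := by
    rw [isProj_iff] at hj ⊢
    simpa [stepCount_append, Nat.sub_eq_zero_of_le i.2.le, Nat.sub_eq_zero_of_le j.2.le] using hj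
  rw [H.area_eq hp, ha]
  simp

theorem area_append_right (h : IsAbove P Q) (h' : IsAbove P' Q') (i : Fin n) :
    area (Fin.append P P') (Fin.append Q Q') (Fin.natAdd m i) = area P' Q' i := by
  obtain ⟨j, hj, ha⟩ := h'.exists_isProj_area i
  have H := (isAbove_append h.stepCount_eq).2 ⟨h, h'⟩
  have hp : IsProj (Fin.append P P') (Fin.append Q Q') (Fin.natAdd m i) (Fin.natAdd m j) := by
    rw [isProj_iff] at hj ⊢
    simpa [stepCount_append, stepCount_of_le P _ (Nat.le_add_right m _),
      stepCount_of_le Q _ (Nat.le_add_right m _), h.stepCount_eq] using hj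
  rw [H.area_eq hp, ha]
  simp [Nat.add_sub_add_left]

/-- A final `N` of `P` against a final `E` of `Q` would put `P` strictly below `Q` one step before
the end. -/
theorem IsAbove.last_eq_east {n : ℕ} {P Q : Path n} (h : IsAbove P Q) (i : Fin n)
    (hi : (i : ℕ) + 1 = n) (hQ : Q i = Step.E) : P i = Step.E := by
  have h1 := stepCount_succ P Step.N i
  have h2 := stepCount_succ Q Step.N i
  have h3 := h.stepCount_eq Step.N
  have h4 := h.stepCount_le i
  rw [hi] at h1 h2
  rw [hQ] at h2
  cases hP : P i with
  | E => rfl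
  | N => simp [hP] at h1 h2; omega

theorem IsAbove.stepCount_last_eq {n : ℕ} {P Q : Path n} (h : IsAbove P Q) (i : Fin n)
    (hi : (i : ℕ) + 1 = n) (hQ : Q i = Step.E) (s : Step) :
    stepCount P s i = stepCount Q s i := by
  have h1 := stepCount_succ P s i
  have h2 := stepCount_succ Q s i
  have h3 := h.stepCount_eq s
  rw [hi] at h1 h2
  rw [h.last_eq_east i hi hQ] at h1
  rw [hQ] at h2
  omega

theorem IsAbove.area_last_eq_zero {n : ℕ} {P Q : Path n} (h : IsAbove P Q) (i : Fin n)
    (hi : (i : ℕ) + 1 = n) (hQ : Q i = Step.E) : area P Q i = 0 := by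
  have hp : IsProj P Q i i := isProj_iff.2
    ⟨(h.last_eq_east i hi hQ).trans hQ.symm, h.stepCount_last_eq i hi hQ _⟩
  simp [h.area_eq hp]

theorem IsAbove.area_first_eq_zero {n : ℕ} {P Q : Path n} (h : IsAbove P Q) (i : Fin n)
    (hi : (i : ℕ) = 0) (hQ : Q i = Step.N) : area P Q i = 0 := by
  obtain ⟨j, hj, ha⟩ := h.exists_isProj_area i
  simp [ha, hQ, hi]

end append

/-! ### Reflection in an antidiagonal -/

/-- The other kind of step. -/
def Step.swap : Step → Step
  | N => E
  | E => N

@[simp]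
theorem Step.swap_swap (s : Step) : s.swap.swap = s := by cases s <;> rfl

theorem Step.swap_eq_iff {s s' : Step} : s.swap = s' ↔ s = s'.swap := by
  cases s <;> cases s' <;> simp [Step.swap]

/-- The reflection of a path in an antidiagonal. -/
def reflect {n : ℕ} (P : Path n) : Path n := fun i => (P i.rev).swap

@[simp]
theorem reflect_reflect {n : ℕ} (P : Path n) : reflect (reflect P) = P := by
  funext i
  simp [reflect]

theorem stepCount_reflect {n : ℕ} (P : Path n) (s : Step) {k : ℕ} (hk : k ≤ n) :
    stepCount (reflect P) s k + stepCount P s.swap (n - k) = stepCount P s.swap n := by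
  have h : stepCount (reflect P) s k =
      ∑ i : Fin n, if (i.rev : ℕ) < k ∧ P i = s.swap then 1 else 0 := by
    rw [stepCount_eq_sum, ← Equiv.sum_comp Fin.revPerm]
    simp [reflect, Step.swap_eq_iff]
  rw [h, stepCount_eq_sum, stepCount_eq_sum, ← sum_add_distrib]
  refine sum_congr rfl fun i _ => ?_
  have hi := i.2
  rw [Fin.val_rev]
  by_cases h1 : P i = s.swap <;> simp only [h1, and_true, and_false, if_false, hi, if_true]
  by_cases h2 : (i : ℕ) < n - k
  · rw [if_pos h2, if_neg (by omega)]
  · rw [if_neg h2, if_pos (by omega)]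

theorem IsAbove.reflect {n : ℕ} {P Q : Path n} (h : IsAbove P Q) :
    IsAbove (reflect P) (reflect Q) := by
  have h1 : ∀ s, stepCount (ShortenedPolyomino.reflect P) s n =
      stepCount (ShortenedPolyomino.reflect Q) s n := fun s => by
    have h1 := stepCount_reflect P s le_rfl
    have h2 := stepCount_reflect Q s le_rfl
    have h3 := h.stepCount_eq s.swap
    simp only [Nat.sub_self, stepCount_zero] at h1 h2
    omega
  refine ⟨h1, fun k => ?_⟩
  rcases le_total k n with hk | hk
  · have h1 := stepCount_reflect P Step.N hk
    have h2 := stepCount_reflect Q Step.N hk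
    have h3 := h.stepCount_eq Step.E
    have h4 := h.stepCount_le (n - k)
    have h5 := stepCount_add_stepCount P (n - k) (Nat.sub_le _ _)
    have h6 := stepCount_add_stepCount Q (n - k) (Nat.sub_le _ _)
    simp only [Step.swap] at h1 h2
    omega
  · rw [stepCount_of_le _ _ hk, stepCount_of_le _ _ hk, h1]

theorem IsAbove.area_reflect {n : ℕ} {P Q : Path n} (h : IsAbove P Q) (i : Fin n) :
    area (ShortenedPolyomino.reflect P) (ShortenedPolyomino.reflect Q) i.rev = area P Q i := by
  obtain ⟨j, hj, ha⟩ := h.exists_isProj_area i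
  have hp : IsProj (ShortenedPolyomino.reflect P) (ShortenedPolyomino.reflect Q) i.rev j.rev := by
    rw [isProj_iff] at hj ⊢
    obtain ⟨h1, h2⟩ := hj
    have h3 := stepCount_reflect P (Q i).swap j.rev.2.le
    have h4 := stepCount_reflect Q (Q i).swap i.rev.2.le
    have h5 := h.stepCount_eq (Q i)
    have h6 := stepCount_succ P (Q i) j
    have h7 := stepCount_succ Q (Q i) i
    -- Reflection makes the end of a step the start of its image, hence counts through `j + 1` and
    -- `i + 1`.
    have h8 : n - (j.rev : ℕ) = j + 1 := by rw [Fin.val_rev]; omega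
    have h9 : n - (i.rev : ℕ) = i + 1 := by rw [Fin.val_rev]; omega
    rw [h8, Step.swap_swap] at h3
    rw [h9, Step.swap_swap] at h4
    rw [if_pos h1] at h6
    rw [if_pos rfl] at h7
    simp only [ShortenedPolyomino.reflect, Fin.rev_rev, h1, true_and] at h3 h4 ⊢
    omega
  rw [h.reflect.area_eq hp, ha]
  simp only [ShortenedPolyomino.reflect, Fin.rev_rev, Fin.val_rev]
  cases Q i <;> simp [Step.swap] <;> omega

/-! ### Statistics on valleys -/

/-- The valley-column area for `b = false`, the valley-row area for `b = true`. -/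
noncomputable def valleyArea (b : Bool) {n : ℕ} (P Q : Path n) : ℕ :=
  ∑ p ∈ valleys Q, area P Q (cond b p.2 p.1)

theorem sum_valleys_reflect {n : ℕ} (Q : Path n) (F : Fin n × Fin n → ℕ) :
    ∑ p ∈ valleys (reflect Q), F p = ∑ p ∈ valleys Q, F (p.2.rev, p.1.rev) := by
  have h1 : ∀ p ∈ valleys (reflect Q), (p.2.rev, p.1.rev) ∈ valleys Q := by
    intro p hp
    simp only [valleys, reflect, Step.swap_eq_iff, mem_filter, mem_univ, true_and,
      Fin.val_rev] at hp ⊢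
    exact ⟨by omega, hp.2.2, hp.2.1⟩
  have h2 : ∀ p ∈ valleys Q, (p.2.rev, p.1.rev) ∈ valleys (reflect Q) := by
    intro p hp
    simp only [valleys, reflect, Step.swap_eq_iff, mem_filter, mem_univ, true_and,
      Fin.val_rev, Fin.rev_rev] at hp ⊢
    exact ⟨by omega, hp.2.2, hp.2.1⟩
  exact sum_nbij' (fun p => (p.2.rev, p.1.rev)) (fun p => (p.2.rev, p.1.rev)) h1 h2
    (by simp) (by simp) (by simp)

theorem val_reflect {n : ℕ} (Q : Path n) : val (reflect Q) = val Q := by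
  simpa [val] using sum_valleys_reflect Q fun _ => 1

theorem IsAbove.valleyArea_reflect {n : ℕ} {P Q : Path n} (h : IsAbove P Q) (b : Bool) :
    valleyArea b (ShortenedPolyomino.reflect P) (ShortenedPolyomino.reflect Q) =
      valleyArea (!b) P Q := by
  rw [valleyArea, sum_valleys_reflect]
  refine sum_congr rfl fun p _ => ?_
  cases b <;> exact h.area_reflect _

/-- The valleys that arise at the junction when two paths are concatenated. -/
def junctions {m n : ℕ} (Q : Path m) (Q' : Path n) : Finset (Fin m × Fin n) :=
  {p | (p.1 : ℕ) + 1 = m ∧ (p.2 : ℕ) = 0 ∧ Q p.1 = Step.E ∧ Q' p.2 = Step.N}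

theorem sum_valleys_append {m n : ℕ} (Q : Path m) (Q' : Path n)
    (F : Fin (m + n) × Fin (m + n) → ℕ) :
    ∑ p ∈ valleys (Fin.append Q Q'), F p =
      ∑ p ∈ valleys Q, F (Fin.castAdd n p.1, Fin.castAdd n p.2) +
      ∑ p ∈ valleys Q', F (Fin.natAdd m p.1, Fin.natAdd m p.2) +
      ∑ p ∈ junctions Q Q', F (Fin.castAdd n p.1, Fin.natAdd m p.2) := by
  -- Index pairs split into four blocks; a pair going from the second path back to the first is
  -- never consecutive.
  have h1 : ∀ (a : Fin m) (b : Fin n), m + (b : ℕ) = a + 1 ↔ (a : ℕ) + 1 = m ∧ (b : ℕ) = 0 := by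
    intro a b; omega
  have h2 : ∀ (a : Fin m) (b : Fin n), ¬ (a : ℕ) = m + b + 1 := by
    intro a b; omega
  have h3 : ∀ (a b : Fin n), m + (a : ℕ) = m + b + 1 ↔ (a : ℕ) = b + 1 := by
    intro a b; omega
  simp only [valleys, junctions, sum_filter, Fintype.sum_prod_type, Fin.sum_univ_add,
    Fin.append_left, Fin.append_right, Fin.val_castAdd, Fin.val_natAdd, sum_add_distrib, h1, h2,
    h3, false_and, if_false, sum_const_zero, and_assoc]
  ring

theorem val_append {m n : ℕ} (Q : Path m) (Q' : Path n) :
    val (Fin.append Q Q') = val Q + val Q' + #(junctions Q Q') := by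
  simpa [val] using sum_valleys_append Q Q' fun _ => 1

/-- A valley at the junction contributes nothing: its `E`-step is the last step of both `P` and `Q`,
and its `N`-step lies in column `0` of the second block. -/
theorem valleyArea_append {m n : ℕ} {P Q : Path m} {P' Q' : Path n} (h : IsAbove P Q)
    (h' : IsAbove P' Q') (b : Bool) :
    valleyArea b (Fin.append P P') (Fin.append Q Q') =
      valleyArea b P Q + valleyArea b P' Q' := by
  rw [valleyArea, sum_valleys_append]
  have h0 : ∑ p ∈ junctions Q Q', area (Fin.append P P') (Fin.append Q Q')
      (cond b (Fin.natAdd m p.2) (Fin.castAdd n p.1)) = 0 := by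
    refine sum_eq_zero fun p hp => ?_
    simp only [junctions, mem_filter, mem_univ, true_and] at hp
    obtain ⟨h1, h2, h3, h4⟩ := hp
    cases b
    · exact (area_append_left h h' _).trans (h.area_last_eq_zero _ h1 h3)
    · exact (area_append_right h h' _).trans (h'.area_first_eq_zero _ h2 h4)
  rw [h0, add_zero]
  congr 1 <;> refine sum_congr rfl fun p _ => ?_
  · cases b <;> exact area_append_left h h' _
  · cases b <;> exact area_append_right h h' _

theorem valleys_of_length_one (Q : Path 1) : valleys Q = ∅ := by
  ext p
  have := p.1.2
  have := p.2.2
  simp only [valleys, mem_filter, mem_univ, true_and, notMem_empty, iff_false]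
  omega

theorem val_of_length_one (Q : Path 1) : val Q = 0 := by
  rw [val, valleys_of_length_one, card_empty]

/-- The path that consists of the single step `s`. -/
def single (s : Step) : Path 1 := fun _ => s

theorem isAbove_single (s : Step) : IsAbove (single s) (single s) :=
  ⟨fun _ => rfl, fun _ => le_rfl⟩

theorem val_single_north_append {n : ℕ} (Q : Path n) :
    val (Fin.append (single Step.N) Q) = val Q := by
  simp [val_append, val_of_length_one, junctions, single]

theorem val_append_single_east {n : ℕ} (Q : Path n) :
    val (Fin.append Q (single Step.E)) = val Q := by
  simp [val_append, val_of_length_one, junctions, single]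

theorem valleyArea_single (b : Bool) (P Q : Path 1) : valleyArea b P Q = 0 := by
  simp [valleyArea, valleys_of_length_one]

/-- The number of last steps of `Q` that are `E`-steps; it is `0` or `1`. -/
def endsEast {n : ℕ} (Q : Path n) : ℕ := #{i : Fin n | (i : ℕ) + 1 = n ∧ Q i = Step.E}

/-- Since the second path starts with `N`, a junction valley depends only on the last step of `Q`.
-/
theorem card_junctions_single_north_append {m n : ℕ} (Q : Path m) (Q' : Path n) :
    #(junctions Q (Fin.append (single Step.N) Q')) = endsEast Q := by
  refine (card_nbij' (fun i => (i, Fin.castAdd n 0)) Prod.fst ?_ ?_ ?_ ?_).symm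
  · intro i hi
    simp only [coe_filter, mem_univ, true_and, Set.mem_ofPred_eq] at hi
    simp only [junctions, coe_filter, mem_univ, true_and, Set.mem_ofPred_eq]
    exact ⟨hi.1, rfl, hi.2, Fin.append_left (single Step.N) Q' 0⟩
  · intro p hp
    simp only [junctions, coe_filter, mem_univ, true_and, Set.mem_ofPred_eq] at hp ⊢
    exact ⟨hp.1, hp.2.2.1⟩
  · intro i _
    rfl
  · rintro ⟨a, c⟩ hp
    simp only [junctions, coe_filter, mem_univ, true_and, Set.mem_ofPred_eq] at hp
    exact Prod.ext rfl (Fin.ext hp.2.1.symm)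

theorem endsEast_succ {n : ℕ} (Q : Path (n + 1)) :
    endsEast Q = if Q (Fin.last n) = Step.E then 1 else 0 := by
  rw [endsEast, card_filter, Fin.sum_univ_castSucc]
  simp only [Fin.val_castSucc, Fin.val_last, true_and, add_eq_right, add_left_inj]
  have : ∀ i : Fin n, ¬ ((i : ℕ) = n) := fun i => by omega
  simp [this]

theorem append_inj_iff {m n : ℕ} {P Q : Path m} {P' Q' : Path n} :
    Fin.append P P' = Fin.append Q Q' ↔ P = Q ∧ P' = Q' := by
  refine ⟨fun h => ⟨funext fun i => ?_, funext fun i => ?_⟩, fun h => by rw [h.1, h.2]⟩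
  · simpa using congrFun h (Fin.castAdd n i)
  · simpa using congrFun h (Fin.natAdd m i)

theorem exists_eq_append {m n : ℕ} (P : Path (m + n)) :
    ∃ (P₁ : Path m) (P₂ : Path n), P = Fin.append P₁ P₂ :=
  ⟨_, _, (Fin.append_castAdd_natAdd (f := P)).symm⟩

/-! ### Decomposition at the first common north step -/

open Classical in
/-- The pairs of paths of length `n` with common end points, the first one weakly above the
second one. -/
noncomputable def above (n : ℕ) : Finset (Path n × Path n) := {p | IsAbove p.1 p.2}

open Classical in
/-- The pairs in `above n` whose first common `N`-step has index `i`. -/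
noncomputable def aboveFirst (n i : ℕ) : Finset (Path n × Path n) :=
  {p | IsAbove p.1 p.2 ∧ IsCommonNorth p.1 p.2 i ∧ ∀ k < i, ¬ IsCommonNorth p.1 p.2 k}

theorem append_mem_aboveFirst {i j : ℕ} {P Q : Path i} {P' Q' : Path j}
    (h : ∀ s, stepCount P s i = stepCount Q s i) :
    (Fin.append P (Fin.append (single Step.N) P'), Fin.append Q (Fin.append (single Step.N) Q')) ∈
      aboveFirst (i + (1 + j)) i ↔ (P, Q) ∈ shortened i ∧ (P', Q') ∈ above j := by
  have h1 : IsCommonNorth (Fin.append P (Fin.append (single Step.N) P'))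
      (Fin.append Q (Fin.append (single Step.N) Q')) i := by
    have := (isCommonNorth_append_add (P' := Fin.append (single Step.N) P')
      (Q' := Fin.append (single Step.N) Q') h 0).2
      ⟨⟨by omega, Fin.append_left (single Step.N) P' 0⟩,
        ⟨by omega, Fin.append_left (single Step.N) Q' 0⟩, by simp⟩
    simpa using this
  have h2 : (∀ k < i, ¬ IsCommonNorth (Fin.append P (Fin.append (single Step.N) P'))
      (Fin.append Q (Fin.append (single Step.N) Q')) k) ↔ ∀ k, ¬ IsCommonNorth P Q k := by
    constructor
    · intro H k hk
      obtain ⟨hki, _⟩ := hk.left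
      exact H k hki ((isCommonNorth_append_of_lt hki).2 hk)
    · intro H k hk
      rw [isCommonNorth_append_of_lt hk]
      exact H k
  simp only [aboveFirst, shortened, above, mem_filter, mem_univ, true_and, isShortened_iff,
    isAbove_append h, isAbove_append (isAbove_single Step.N).stepCount_eq, isAbove_single, h1, h2]
  tauto

theorem exists_append_of_mem_aboveFirst {i j : ℕ} {p : Path (i + (1 + j)) × Path (i + (1 + j))}
    (hp : p ∈ aboveFirst (i + (1 + j)) i) :
    ∃ P Q : Path i, ∃ P' Q' : Path j, (∀ s, stepCount P s i = stepCount Q s i) ∧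
      p = (Fin.append P (Fin.append (single Step.N) P'),
        Fin.append Q (Fin.append (single Step.N) Q')) := by
  obtain ⟨A, B⟩ := p
  obtain ⟨P, A, rfl⟩ := exists_eq_append A
  obtain ⟨Q, B, rfl⟩ := exists_eq_append B
  obtain ⟨S, P', rfl⟩ := exists_eq_append A
  obtain ⟨T, Q', rfl⟩ := exists_eq_append B
  simp only [aboveFirst, mem_filter, mem_univ, true_and] at hp
  have hc := hp.2.1
  have h : ∀ s, stepCount P s i = stepCount Q s i := fun s => by
    simpa [stepCount_append] using hc.stepCount_eq s
  have hc' := (isCommonNorth_append_add h 0).1 (by simpa using hc)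
  obtain ⟨_, h1⟩ := hc'.left
  obtain ⟨_, h2⟩ := hc'.right
  have hS : S = single Step.N := funext fun x => by
    rw [Fin.eq_zero x]
    exact (Fin.append_left S P' 0).symm.trans h1
  have hT : T = single Step.N := funext fun x => by
    rw [Fin.eq_zero x]
    exact (Fin.append_left T Q' 0).symm.trans h2
  exact ⟨P, Q, P', Q', h, by rw [hS, hT]⟩

theorem shortened_subset_above (n : ℕ) : shortened n ⊆ above n := by
  intro p hp
  simp only [shortened, above, mem_filter, mem_univ, true_and] at hp ⊢
  exact (isShortened_iff.1 hp).1

/-! ### Generating functions and the recursion -/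

section weight

variable {R : Type*} [CommRing R] (q t : R)

/-- The weight of a pair of paths. -/
noncomputable def weight (b : Bool) {n : ℕ} (p : Path n × Path n) : R :=
  q ^ valleyArea b p.1 p.2 * t ^ val p.2

/-- Reflection is an involution of `above n` that swaps the two areas. -/
theorem sum_above_weight (n : ℕ) :
    ∑ p ∈ above n, weight q t false p = ∑ p ∈ above n, weight q t true p := by
  have h : ∀ p ∈ above n, (reflect p.1, reflect p.2) ∈ above n := by
    intro p hp
    simp only [above, mem_filter, mem_univ, true_and] at hp ⊢
    exact hp.reflect
  refine sum_nbij' (fun p => (reflect p.1, reflect p.2)) (fun p => (reflect p.1, reflect p.2))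
    h h (by simp) (by simp) fun p hp => ?_
  simp only [above, mem_filter, mem_univ, true_and] at hp
  simp [weight, hp.valleyArea_reflect, val_reflect]

theorem sum_aboveFirst_weight (b : Bool) (i j : ℕ) :
    ∑ p ∈ aboveFirst (i + (1 + j)) i, weight q t b p =
      (∑ p ∈ shortened i, weight q t b p * t ^ endsEast p.2) * ∑ p ∈ above j, weight q t b p := by
  rw [sum_mul_sum, ← sum_product']
  symm
  refine sum_nbij (fun x => (Fin.append x.1.1 (Fin.append (single Step.N) x.2.1),
    Fin.append x.1.2 (Fin.append (single Step.N) x.2.2))) ?_ ?_ ?_ ?_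
  · rintro ⟨⟨P, Q⟩, P', Q'⟩ hx
    rw [mem_product] at hx
    have h : IsAbove P Q := by simpa [above] using shortened_subset_above i hx.1
    exact (append_mem_aboveFirst h.stepCount_eq).2 hx
  · rintro ⟨⟨P, Q⟩, P', Q'⟩ _ ⟨⟨A, B⟩, A', B'⟩ _ hx
    simp only [Prod.mk.injEq, append_inj_iff, true_and] at hx ⊢
    tauto
  · intro p hp
    obtain ⟨P, Q, P', Q', h, rfl⟩ := exists_append_of_mem_aboveFirst hp
    refine ⟨((P, Q), P', Q'), ?_, rfl⟩
    simpa using (append_mem_aboveFirst h).1 hp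
  · rintro ⟨⟨P, Q⟩, P', Q'⟩ hx
    rw [mem_product] at hx
    have h1 : IsAbove P Q := by simpa [above] using shortened_subset_above i hx.1
    have h2 : IsAbove P' Q' := by simpa [above] using hx.2
    have h3 := (isAbove_append (isAbove_single Step.N).stepCount_eq).2 ⟨isAbove_single Step.N, h2⟩
    simp only [weight]
    -- The inserted `N` adds no area; its junction with the prefix supplies `t ^ endsEast`.
    rw [valleyArea_append h1 h3, valleyArea_append (isAbove_single Step.N) h2, val_append,
      val_single_north_append, card_junctions_single_north_append, valleyArea_single]
    ring

theorem isShortened_append_single_east {n : ℕ} {P Q : Path n}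
    (h : ∀ s, stepCount P s n = stepCount Q s n) :
    IsShortened (Fin.append P (single Step.E)) (Fin.append Q (single Step.E)) ↔
      IsShortened P Q := by
  have h1 : IsShortened (single Step.E) (single Step.E) := isShortened_iff.2
    ⟨isAbove_single _, fun k hk => by obtain ⟨_, h⟩ := hk.left; cases h⟩
  rw [isShortened_append h, and_iff_left h1]

/-- A final `E` of `Q` is shared by `P`; as common `E`-steps are allowed, deleting it is a
bijection, and it belongs to no valley. -/
theorem sum_shortened_weight_of_last_east (b : Bool) (n : ℕ) :
    ∑ p ∈ shortened (n + 1) with p.2 (Fin.last n) = Step.E, weight q t b p =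
      ∑ p ∈ shortened n, weight q t b p := by
  symm
  refine sum_nbij (fun p => (Fin.append p.1 (single Step.E), Fin.append p.2 (single Step.E)))
    ?_ ?_ ?_ ?_
  · rintro ⟨P, Q⟩ hp
    simp only [shortened, mem_filter, mem_univ, true_and] at hp ⊢
    exact ⟨(isShortened_append_single_east (isShortened_iff.1 hp).1.stepCount_eq).2 hp,
      Fin.append_right Q (single Step.E) 0⟩
  · rintro ⟨P, Q⟩ _ ⟨P', Q'⟩ _ hp
    simpa [append_inj_iff] using hp
  · rintro ⟨A, B⟩ hp
    simp only [shortened, coe_filter, mem_filter, mem_univ, true_and, Set.mem_ofPred_eq] at hp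
    obtain ⟨hs, hB⟩ := hp
    have hA := (isShortened_iff.1 hs).1
    have hA' := hA.last_eq_east (Fin.last n) rfl hB
    have h := hA.stepCount_last_eq (Fin.last n) rfl hB
    obtain ⟨P, S, rfl⟩ := exists_eq_append A
    obtain ⟨Q, T, rfl⟩ := exists_eq_append B
    have hS : S = single Step.E := funext fun x => by
      rw [Fin.eq_zero x]
      exact (Fin.append_right P S 0).symm.trans hA'
    have hT : T = single Step.E := funext fun x => by
      rw [Fin.eq_zero x]
      exact (Fin.append_right Q T 0).symm.trans hB
    subst hS hT
    have h' : ∀ s, stepCount P s n = stepCount Q s n := fun s => by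
      simpa [stepCount_append] using h s
    exact ⟨(P, Q), by simpa [shortened] using (isShortened_append_single_east h').1 hs, rfl⟩
  · rintro ⟨P, Q⟩ hp
    simp only [shortened, mem_filter, mem_univ, true_and] at hp
    simp only [weight]
    rw [valleyArea_append (isShortened_iff.1 hp).1 (isAbove_single _), valleyArea_single,
      val_append_single_east, add_zero]

/-- The factor is `1 + (t - 1)` when `Q` ends in `E` and `1` otherwise. -/
theorem sum_shortened_weight_mul_endsEast (b : Bool) (n : ℕ) :
    ∑ p ∈ shortened (n + 1), weight q t b p * t ^ endsEast p.2 =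
      ∑ p ∈ shortened (n + 1), weight q t b p + (t - 1) * ∑ p ∈ shortened n, weight q t b p := by
  rw [← sum_shortened_weight_of_last_east q t b n, sum_filter, mul_sum, ← sum_add_distrib]
  refine sum_congr rfl fun p _ => ?_
  rw [endsEast_succ]
  split_ifs <;> ring

theorem sum_above_eq (b : Bool) (n : ℕ) :
    ∑ p ∈ above n, weight q t b p = ∑ p ∈ shortened n, weight q t b p +
      ∑ i ∈ range n, ∑ p ∈ aboveFirst n i, weight q t b p := by
  classical
  have hd : ((range n : Finset ℕ) : Set ℕ).PairwiseDisjoint (aboveFirst n) := by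
    intro i _ j _ hij
    refine disjoint_left.2 fun p hi hj => ?_
    simp only [aboveFirst, mem_filter, mem_univ, true_and] at hi hj
    rcases lt_or_gt_of_ne hij with h | h
    · exact hj.2.2 i h hi.2.1
    · exact hi.2.2 j h hj.2.1
  rw [← sum_biUnion hd, ← sum_union]
  · congr 1
    ext p
    simp only [above, shortened, aboveFirst, mem_union, mem_biUnion, mem_filter, mem_univ,
      true_and, mem_range, isShortened_iff]
    constructor
    · intro h
      by_cases hc : ∃ k, IsCommonNorth p.1 p.2 k
      · obtain ⟨hk, _⟩ := (Nat.find_spec hc).left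
        exact Or.inr ⟨Nat.find hc, hk, h, Nat.find_spec hc, fun k => Nat.find_min hc⟩
      · exact Or.inl ⟨h, not_exists.1 hc⟩
    · rintro (h | ⟨_, _, h, _⟩)
      exacts [h.1, h]
  · refine disjoint_left.2 fun p h h' => ?_
    simp only [shortened, aboveFirst, mem_biUnion, mem_filter, mem_univ, true_and,
      isShortened_iff] at h h'
    obtain ⟨i, _, _, hi, _⟩ := h'
    exact h.2 i hi

theorem sum_shortened_weight (n : ℕ) :
    ∑ p ∈ shortened n, weight q t false p = ∑ p ∈ shortened n, weight q t true p := by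
  induction n using Nat.strong_induction_on with
  | _ n ih =>
    have h := sum_above_weight q t n
    rw [sum_above_eq, sum_above_eq] at h
    -- Each summand involves only shortened polyominoes of sizes `i` and `i - 1`, both below `n`.
    have h' : ∑ i ∈ range n, ∑ p ∈ aboveFirst n i, weight q t false p =
        ∑ i ∈ range n, ∑ p ∈ aboveFirst n i, weight q t true p := by
      refine sum_congr rfl fun i hi => ?_
      rw [mem_range] at hi
      obtain ⟨j, rfl⟩ : ∃ j, n = i + (1 + j) := ⟨n - i - 1, by omega⟩
      rw [sum_aboveFirst_weight, sum_aboveFirst_weight, sum_above_weight]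
      congr 1
      cases i with
      | zero => simp [weight, valleyArea, valleys]
      | succ i =>
        rw [sum_shortened_weight_mul_endsEast, sum_shortened_weight_mul_endsEast, ih _ hi,
          ih i (by omega)]
    rw [h'] at h
    exact add_right_cancel h

end weight

end ShortenedPolyomino

theorem mainTheorem8 (n : ℕ) (hn : 1 ≤ n) :
    (∑ p ∈ ShortenedPolyomino.shortened n,
        (MvPolynomial.X 0 : MvPolynomial (Fin 2) ℤ) ^ ShortenedPolyomino.vcarea p.1 p.2 *
          MvPolynomial.X 1 ^ ShortenedPolyomino.val p.2) =
      ∑ p ∈ ShortenedPolyomino.shortened n,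
        (MvPolynomial.X 0 : MvPolynomial (Fin 2) ℤ) ^ ShortenedPolyomino.vrarea p.1 p.2 *
          MvPolynomial.X 1 ^ ShortenedPolyomino.val p.2 :=
  -- `vcarea` and `vrarea` are definitionally `valleyArea false` and `valleyArea true`.
  ShortenedPolyomino.sum_shortened_weight _ _ n
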